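/- Let $q$ be a prime power, $n\ge 1$ an integer with $q\equiv 1 \pmod n$ if $n$ is odd and $q\equiv 1\pmod{2n}$ if $n$ is even. For $r\geq 1$ let $\Gamma_r=\operatorname{Hom}(\mathbb{F}_{q^r}^\times,\mathbb{C}^\times)$, and regard $\Gamma_1$ as a subgroup of $\Gamma_r$ through composition with the norm $\mathbb{F}_{q^r}^\times\to\mathbb{F}_q^\times$. Fix a generator $\delta$ of $\Gamma_1$ and an element $\zeta_n\in\mathbb{F}_q^\times$ of order $n$. Let $D,\hat d,t$ be divisors of $n$ with $D\mid t\hat d$ and $\hat d\mid D$, and let $\vec\lambda=(\lambda_1,\dots,\lambda_m)$ be positive integers with $n=\hat d\,t\sum_{i=1}^m\lambda_i$. Put $s=(q-1)/t$ and $\hat t=t\hat d/D$. For a class $[\alpha]\in\Gamma_D/\langle\delta^s\rangle$ write $\{[\alpha]\}=\{[\alpha]^{q^i}: i\ge 0\}$ for its Frobenius orbit and $\deg([\alpha])$ for the size of this orbit (the newdegree of $\alpha$). Evaluation $\alpha\mapsto\alpha(\zeta_n^{\hat t})$ on $\Gamma_D$ is well defined on $\Gamma_D/\langle\delta^s\rangle$;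 set $$\widehat Z(D,t,\hat d,\vec\lambda)=\sum_{\substack{([\alpha_1],\dots,[\alpha_m])\in(\Gamma_D/\langle\delta^s\rangle)^m\\ \{[\alpha_i]\}\ne\{[\alpha_j]\}\ (i\neq j)\\ \deg([\alpha_i])=\hat d\ (1\le i\le m)}}\ \prod_{i=1}^m\alpha_i^{\lambda_i}(\zeta_n^{\hat t}).$$ Then $$\widehat Z(D,t,\hat d,\vec\lambda)=\begin{cases}\mu(\hat d)\,(-\hat d)^{m-1}\,(m-1)!\,\dfrac{q-1}{t} & \text{if }\gcd(D,t)=1,\\[1ex] 0&\text{otherwise,}\end{cases}$$ where $\mu$ is the Möbius function. -/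

import Mathlib

namespace NewDegree

/-- The complex character group of the multiplicative group of a field `k`. For `k` the field
with `q ^ r` elements this is `Γ_r`. -/
def CharGroup (k : Type*) [Field k] : Type _ := kˣ →* ℂˣ

/-- The group structure on characters is pointwise multiplication. -/
noncomputable instance (k : Type*) [Field k] : CommGroup (CharGroup k) :=
  inferInstanceAs (CommGroup (kˣ →* ℂˣ))

instance (k : Type*) [Field k] : FunLike (CharGroup k) kˣ ℂˣ :=
  inferInstanceAs (FunLike (kˣ →* ℂˣ) kˣ ℂˣ)

instance (k : Type*) [Field k] : MonoidHomClass (CharGroup k) kˣ ℂˣ :=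
  inferInstanceAs (MonoidHomClass (kˣ →* ℂˣ) kˣ ℂˣ)

instance (k : Type*) [Field k] [Finite k] : Finite (CharGroup k) :=
  inferInstanceAs (Finite (kˣ →* ℂˣ))

theorem CharGroup.mul_apply {k : Type*} [Field k] (α β : CharGroup k) (x : kˣ) :
    (α * β) x = α x * β x := rfl

/-- Evaluation of characters at a fixed element. -/
noncomputable def CharGroup.eval {k : Type*} [Field k] (x : kˣ) : CharGroup k →* ℂˣ where
  toFun α := α x
  map_one' := rfl
  map_mul' _ _ := rfl

/-- The norm map on unit groups of a field extension. -/
noncomputable def unitNorm (F K : Type*) [Field F] [Field K] [Algebra F K] : Kˣ →* Fˣ :=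
  Units.map (Algebra.norm F)

/-- The transpose of the norm, the inclusion of `Γ_1` in `Γ_D`. -/
noncomputable def normTranspose (F K : Type*) [Field F] [Field K] [Algebra F K] :
    CharGroup F →* CharGroup K where
  toFun β := MonoidHom.comp (β : Fˣ →* ℂˣ) (unitNorm F K)
  map_one' := rfl
  map_mul' _ _ := rfl

/-- The quotient of the characters of `Kˣ` by the cyclic subgroup generated by `δ ^ s`, where
`s = (q - 1) / t`, `q` is the cardinality of `F`, and `δ` is regarded as a character of `Kˣ`. -/
abbrev CharClass {F : Type*} (K : Type*) [Field F] [Field K] [Algebra F K]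
    (δ : CharGroup F) (t : ℕ) : Type _ :=
  CharGroup K ⧸ Subgroup.zpowers (normTranspose F K (δ ^ ((Nat.card F - 1) / t)))

/-- The orbit of an element of a commutative group under the Frobenius action `c ↦ c ^ q`. -/
def frobOrbit {G : Type*} [CommGroup G] (q : ℕ) (c : G) : Set G :=
  Set.range fun i : ℕ => c ^ q ^ i

/-- The degree of an element: the size of its Frobenius orbit. The degree of the class of a
character in `CharClass` is the newdegree of the character. -/
noncomputable def frobDegree {G : Type*} [CommGroup G] (q : ℕ) (c : G) : ℕ :=
  (frobOrbit q c).ncard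

/-- The element `ζ ^ (t d̂ / D)` of `Kˣ`, for `ζ` in `Fˣ`, where `D` is the degree of `K` over
`F`. -/
noncomputable def evalPoint {F : Type*} (K : Type*) [Field F] [Field K] [Algebra F K]
    (ζ : Fˣ) (t dhat : ℕ) : Kˣ :=
  Units.map (algebraMap F K : F →* K) ζ ^ (t * dhat / Module.finrank F K)

section

variable {F K : Type*} [Field F] [Field K] [Algebra F K]
  {δ : CharGroup F} {ζ : Fˣ} {n D t dhat : ℕ}

/-- The character `δ ^ s` of `Kˣ` is trivial at `ζ ^ (t d̂ / D)`. -/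
theorem normTranspose_evalPoint (hζ : orderOf ζ = n) (hD : Module.finrank F K = D)
    (ht : t ∣ n) (hDt : D ∣ t * dhat) :
    normTranspose F K (δ ^ ((Nat.card F - 1) / t)) (evalPoint K ζ t dhat) = 1 := by
  have hcard : Nat.card Fˣ = Nat.card F - 1 := Nat.card_units F
  have htq : t ∣ Nat.card F - 1 := by
    rw [← hcard]
    exact ht.trans (hζ ▸ orderOf_dvd_natCard ζ)
  have hnorm : unitNorm F K (Units.map (algebraMap F K : F →* K) ζ) = ζ ^ D := by
    ext
    simp [unitNorm, Algebra.norm_algebraMap, hD]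
  have h1 : ζ ^ (Nat.card F - 1) = 1 := by rw [← hcard]; exact pow_card_eq_one'
  have hpow (k : ℕ) (y : Fˣ) : (δ ^ k) y = δ y ^ k := map_pow (CharGroup.eval y) δ k
  obtain ⟨u, hu⟩ := hDt
  obtain ⟨s, hs⟩ := htq
  have hmul : D * (t * dhat / D) = t * dhat := Nat.mul_div_cancel' ⟨u, hu⟩
  change (δ ^ ((Nat.card F - 1) / t)) (unitNorm F K (evalPoint K ζ t dhat)) = 1
  rw [evalPoint, map_pow, hnorm, hD, ← pow_mul, hmul, hpow, ← map_pow,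
    ← pow_mul]
  have h2 : t * dhat * ((Nat.card F - 1) / t) = (Nat.card F - 1) * dhat := by
    rw [mul_right_comm, Nat.mul_div_cancel' ⟨s, hs⟩]
  rw [h2, pow_mul, h1, one_pow, map_one]

/-- Evaluation of a class of characters of `Kˣ` at `ζ ^ (t d̂ / D)`, computed on any
representative. -/
noncomputable def evalClass (δ : CharGroup F) (hζ : orderOf ζ = n)
    (hD : Module.finrank F K = D) (ht : t ∣ n) (hDt : D ∣ t * dhat) :
    CharClass K δ t →* ℂˣ :=
  QuotientGroup.lift _ (CharGroup.eval (evalPoint K ζ t dhat)) <| by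
    rw [Subgroup.zpowers_le]
    exact normTranspose_evalPoint hζ hD ht hDt

theorem evalClass_mk (hζ : orderOf ζ = n) (hD : Module.finrank F K = D) (ht : t ∣ n)
    (hDt : D ∣ t * dhat) (α : CharGroup K) :
    evalClass δ hζ hD ht hDt (QuotientGroup.mk α) = α (evalPoint K ζ t dhat) :=
  rfl

end

open scoped Classical in
/-- The sum, over the `m`-tuples of classes of characters of `Kˣ` modulo `δ ^ s` which all have
newdegree `d̂` and have pairwise distinct Frobenius orbits, of the products of the
`α_i ^ λ_i (ζ ^ (t d̂ / D))`. -/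
noncomputable def Zhat {F K : Type*} [Field F] [Field K] [Finite K] [Algebra F K]
    {ζ : Fˣ} {n D t dhat : ℕ} (δ : CharGroup F) (hζ : orderOf ζ = n)
    (hD : Module.finrank F K = D) (ht : t ∣ n) (hDt : D ∣ t * dhat)
    {m : ℕ} (lam : Fin m → ℕ) : ℂ :=
  letI : Fintype (CharClass K δ t) := Fintype.ofFinite _
  ∑ c : Fin m → CharClass K δ t with
      (∀ i j, i ≠ j → frobOrbit (Nat.card F) (c i) ≠ frobOrbit (Nat.card F) (c j)) ∧
      (∀ i, frobDegree (Nat.card F) (c i) = dhat),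
    ∏ i, ((evalClass δ hζ hD ht hDt (c i) : ℂˣ) : ℂ) ^ lam i

end NewDegree

/-!
Evaluation is a character `χ` on a cyclic group `G` of order `N = (q ^ D - 1) / t`, and `χ` takes
the value of a generator to a root of unity of order `D * L`, where `L = ∑ i, λ i`. The value of `χ`
is constant on Frobenius orbits, so summing over the first entry of a tuple expresses the sum over
tuples in distinct orbits by power sums `p k = ∑ χ c ^ k`, over the `c` of degree `d̂`, and by
sums over shorter tuples in which `λ 0` is merged with another exponent.

Translation by an element fixed by Frobenius preserves degrees, hence `p k = 0` unless `χ ^ k` is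
trivial on these elements, which happens exactly when `gcd(D, t) * L` divides `k`. So at most `p L`
survives the recursion, and it does only if `gcd(D, t) = 1`, in which case `d̂ = D`. Möbius
inversion writes `p L` as a signed combination of the sums of `χ ^ L` over the kernels of
`c ↦ c ^ (q ^ e - 1)` for `e ∣ D`, and of these only `e = 1`, with sum `(q - 1) / t`, contributes.
-/

namespace NewDegree

open Finset

section Arithmetic

theorem geom_sum_succ_eq_add_mul (N D : ℕ) :
    ∑ i ∈ range D, (N + 1) ^ i = D + N * ∑ i ∈ range D, ∑ j ∈ range i, (N + 1) ^ j := by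
  calc ∑ i ∈ range D, (N + 1) ^ i
      = ∑ i ∈ range D, ((∑ j ∈ range i, (N + 1) ^ j) * N + 1) := by simp only [geom_sum_mul_add]
    _ = D + N * ∑ i ∈ range D, ∑ j ∈ range i, (N + 1) ^ j := by
      rw [sum_add_distrib, ← sum_mul, sum_const, card_range, smul_eq_mul, mul_one, mul_comm N,
        add_comm]

theorem dvd_two_mul_sum_geom_sum {N D : ℕ} (hDN : D ∣ N) :
    D ∣ 2 * ∑ i ∈ range D, ∑ j ∈ range i, (N + 1) ^ j := by
  have hpow (j : ℕ) : (N + 1) ^ j ≡ 1 [MOD D] := by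
    simpa using ((Nat.modEq_zero_iff_dvd.2 hDN).add_right 1).pow j
  have hgeom (i : ℕ) : ∑ j ∈ range i, (N + 1) ^ j ≡ i [MOD D] := by
    simpa using Nat.ModEq.sum (s := range i) fun j _ => hpow j
  have hsum := (Nat.ModEq.sum (s := range D) fun i _ => hgeom i).mul_left 2
  rw [hsum.dvd_iff dvd_rfl, mul_comm, sum_range_id_mul_two]
  exact dvd_mul_right _ _

/- Writing the sum as `D + N * T`, the factor `T` is congruent to `D (D - 1) / 2` modulo `D`, so for
even `D` it is only a multiple of `D / 2`; that `4` divides `N` makes up for the missing factor. -/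
theorem exists_geom_sum_succ_eq_mul {N D : ℕ} (hDN : D ∣ N) (h4 : Even D → 4 ∣ N) :
    ∃ u : ℕ, ∑ i ∈ range D, (N + 1) ^ i = D * u ∧ u.Coprime N := by
  have hT := dvd_two_mul_sum_geom_sum hDN
  rw [geom_sum_succ_eq_add_mul]
  set T := ∑ i ∈ range D, ∑ j ∈ range i, (N + 1) ^ j
  rcases D.even_or_odd with hD | hD
  · obtain ⟨r, rfl⟩ := h4 hD
    obtain ⟨a, ha⟩ := hT
    have hcop : (1 + 2 * r * a).Coprime (2 * r) := by simp
    refine ⟨1 + 2 * r * a, by linear_combination 2 * r * ha, ?_⟩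
    have h := Nat.Coprime.mul_right (hcop.coprime_mul_right_right) hcop
    rwa [show 2 * (2 * r) = 4 * r by ring] at h
  · obtain ⟨a, ha⟩ := hD.coprime_two_right.dvd_of_dvd_mul_left hT
    exact ⟨1 + N * a, by rw [ha]; ring, by simp⟩

theorem exists_pow_sub_one_eq_mul {q D : ℕ} (hq : 0 < q) (hD : D ∣ q - 1)
    (h4 : Even D → 4 ∣ q - 1) :
    ∃ u : ℕ, q ^ D - 1 = (q - 1) * (D * u) ∧ u.Coprime (q - 1) := by
  obtain ⟨N, rfl⟩ : ∃ N, q = N + 1 := ⟨q - 1, by omega⟩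
  simp only [Nat.add_sub_cancel] at hD h4 ⊢
  obtain ⟨u, hu, hcop⟩ := exists_geom_sum_succ_eq_mul hD h4
  exact ⟨u, by rw [← geom_sum_mul_add N D, Nat.add_sub_cancel, hu, mul_comm], hcop⟩

variable {q D t N : ℕ}

theorem exists_eq_mul_of_mul_eq_pow_sub_one (hq : 1 < q) (ht : t ∣ q - 1) (hD : D ∣ q - 1)
    (h4 : Even D → 4 ∣ q - 1) (hN : t * N = q ^ D - 1) :
    ∃ u : ℕ, N = (q - 1) / t * (D * u) ∧ u.Coprime (q - 1) := by
  obtain ⟨u, hu, hcop⟩ := exists_pow_sub_one_eq_mul (by omega) hD h4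
  have ht0 : 0 < t := Nat.pos_of_dvd_of_pos ht (by omega)
  refine ⟨u, Nat.eq_of_mul_eq_mul_left ht0 ?_, hcop⟩
  rw [hN, hu, ← mul_assoc t, Nat.mul_div_cancel' ht]

theorem gcd_sub_one_eq_mul_gcd (hq : 1 < q) (ht : t ∣ q - 1) (hD : D ∣ q - 1)
    (h4 : Even D → 4 ∣ q - 1) (hN : t * N = q ^ D - 1) :
    N.gcd (q - 1) = (q - 1) / t * D.gcd t := by
  obtain ⟨u, rfl, hcop⟩ := exists_eq_mul_of_mul_eq_pow_sub_one hq ht hD h4 hN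
  nth_rw 2 [← Nat.div_mul_cancel ht]
  rw [Nat.gcd_mul_left, Nat.Coprime.gcd_mul_right_cancel D (hcop.coprime_dvd_right ht)]

theorem mul_dvd_mul_div_gcd_sub_one_iff {L k : ℕ} (hq : 1 < q) (htL : t * L ∣ q - 1)
    (hD : D ∣ q - 1) (h4 : Even D → 4 ∣ q - 1) (hN : t * N = q ^ D - 1) :
    D * L ∣ k * (N / N.gcd (q - 1)) ↔ D.gcd t * L ∣ k := by
  have ht : t ∣ q - 1 := dvd_of_mul_right_dvd htL
  have hD0 : 0 < D := Nat.pos_of_dvd_of_pos hD (by omega)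
  have hs0 : 0 < (q - 1) / t :=
    Nat.div_pos (Nat.le_of_dvd (by omega) ht) (Nat.pos_of_dvd_of_pos ht (by omega))
  rw [gcd_sub_one_eq_mul_gcd hq ht hD h4 hN]
  obtain ⟨u, rfl, hcop⟩ := exists_eq_mul_of_mul_eq_pow_sub_one hq ht hD h4 hN
  have hcop' : (D.gcd t * L).Coprime u :=
    (hcop.coprime_dvd_right ((mul_dvd_mul_right (D.gcd_dvd_right t) L).trans htL)).symm
  have hg0 : 0 < D.gcd t := Nat.gcd_pos_of_pos_left t hD0
  obtain ⟨E, hE⟩ := D.gcd_dvd_left t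
  have hE0 : 0 < E := Nat.pos_of_mul_pos_left (hE ▸ hD0)
  have hquot : (q - 1) / t * (D * u) / ((q - 1) / t * D.gcd t) = E * u := by
    rw [Nat.mul_div_mul_left _ _ hs0]
    exact Nat.div_eq_of_eq_mul_right hg0 (by rw [← mul_assoc, ← hE])
  have hDL : D * L = E * (D.gcd t * L) := by rw [← mul_assoc, mul_comm E, ← hE]
  rw [hquot, hDL, mul_left_comm k, Nat.mul_dvd_mul_iff_left hE0]
  exact ⟨hcop'.dvd_of_dvd_mul_right, fun h => h.mul_right u⟩

theorem eq_one_of_dvd_div_gcd_pow_sub_one {e : ℕ} (hq : 1 < q) (hD : D ∣ q - 1)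
    (h4 : Even D → 4 ∣ q - 1) (hN : t * N = q ^ D - 1) (he : e ∣ D)
    (h : D ∣ N / N.gcd (q ^ e - 1)) : e = 1 := by
  obtain ⟨u, hu, hcop⟩ := exists_pow_sub_one_eq_mul (by omega) hD h4
  obtain ⟨v, hv, -⟩ := exists_pow_sub_one_eq_mul (by omega) (he.trans hD)
    fun h => h4 (h.trans_dvd he)
  have hdvd_gcd : q ^ e - 1 ∣ t * N.gcd (q ^ e - 1) := by
    rw [← Nat.gcd_mul_left, hN]
    exact Nat.dvd_gcd (Nat.pow_sub_one_dvd_pow_sub_one q he) (dvd_mul_left _ _)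
  have hdvd : (q - 1) * (D * (e * v)) ∣ (q - 1) * (D * u) := by
    calc (q - 1) * (D * (e * v)) = D * (q ^ e - 1) := by rw [hv, mul_left_comm]
      _ ∣ N / N.gcd (q ^ e - 1) * (t * N.gcd (q ^ e - 1)) := mul_dvd_mul h hdvd_gcd
      _ = t * N := by rw [mul_left_comm, Nat.div_mul_cancel (Nat.gcd_dvd_left _ _)]
      _ = (q - 1) * (D * u) := hN.trans hu
  have hD0 : 0 < D := Nat.pos_of_dvd_of_pos hD (by omega)
  rw [Nat.mul_dvd_mul_iff_left (by omega), Nat.mul_dvd_mul_iff_left hD0] at hdvd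
  exact Nat.Coprime.eq_one_of_dvd (hcop.coprime_dvd_right (he.trans hD)).symm
    (dvd_of_mul_right_dvd hdvd)

theorem coprime_of_mul_eq_pow_sub_one (hq : 0 < q) (hD : D ≠ 0) (hN : t * N = q ^ D - 1) :
    N.Coprime q := by
  have h : (q ^ D - 1).Coprime (q ^ D) :=
    (Nat.coprime_self_sub_left (Nat.one_le_pow D q hq)).2 (Nat.coprime_one_left _)
  exact (h.coprime_dvd_left (hN ▸ dvd_mul_left N t)).coprime_dvd_right (dvd_pow_self q hD)

end Arithmetic

section DistinctFibers

open scoped Classical in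
/-- The sum of `∏ i, f (c i) ^ lam i` over the tuples `c` whose entries lie in pairwise distinct
fibres of `o`. -/
noncomputable def distinctFiberSum {α β R : Type*} [Fintype α] [CommSemiring R] (o : α → β)
    (f : α → R) {m : ℕ} (lam : Fin m → ℕ) : R :=
  ∑ c : Fin m → α with Function.Injective (o ∘ c), ∏ i, f (c i) ^ lam i

variable {α β R : Type*} [Fintype α] {o : α → β} {f : α → R} {d m : ℕ}

open scoped Classical in
theorem distinctFiberSum_eq_sum_mul_sum [CommSemiring R] (lam : Fin (m + 1) → ℕ) :
    distinctFiberSum o f lam = ∑ c : Fin m → α with Function.Injective (o ∘ c),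
      (∏ i, f (c i) ^ lam i.succ) * ∑ x with o x ∉ Set.range (o ∘ c), f x ^ lam 0 := by
  have hcons (c : Fin m → α) (x : α) :
      Function.Injective (o ∘ (Fin.cons x c : Fin (m + 1) → α)) ↔
        Function.Injective (o ∘ c) ∧ o x ∉ Set.range (o ∘ c) := by
    rw [Fin.comp_cons, Fin.cons_injective_iff, and_comm]
  rw [distinctFiberSum, sum_filter, ← (Fin.consEquiv fun _ => α).sum_comp,
    Fintype.sum_prod_type_right, sum_filter]
  refine sum_congr rfl fun c _ => ?_
  simp only [hcons, Fin.consEquiv, Equiv.coe_fn_mk, Fin.prod_univ_succ, Fin.cons_zero,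
    Fin.cons_succ]
  by_cases hc : Function.Injective (o ∘ c)
  · simp only [hc, true_and, if_true, ← sum_filter, ← sum_mul, mul_comm]
  · simp only [hc, false_and, if_false, sum_const_zero]

variable [CommRing R]

open scoped Classical in
theorem sum_notMem_range_comp_eq_sub (hd : ∀ x, #{y | o y = o x} = d) (hf : f.FactorsThrough o)
    {c : Fin m → α} (hc : Function.Injective (o ∘ c)) (k : ℕ) :
    ∑ x with o x ∉ Set.range (o ∘ c), f x ^ k = ∑ x, f x ^ k - d * ∑ i, f (c i) ^ k := by
  have hfiber (i : Fin m) : ∑ x with o x = o (c i), f x ^ k = d * f (c i) ^ k := by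
    rw [sum_congr rfl fun x hx => by rw [hf (mem_filter.1 hx).2], sum_const, hd, nsmul_eq_mul]
  have hmem : ∑ x with o x ∈ Set.range (o ∘ c), f x ^ k = d * ∑ i, f (c i) ^ k := by
    rw [mul_sum, ← sum_congr rfl fun i _ => hfiber i, ← sum_biUnion]
    · refine sum_congr ?_ fun _ _ => rfl
      ext x
      simp [eq_comm]
    · intro i _ j _ hij
      exact disjoint_filter.2 fun x _ hi hj => hij (hc (hi.symm.trans hj))
  rw [eq_sub_iff_add_eq', ← hmem, sum_filter_add_sum_filter_not]

open scoped Classical in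
theorem distinctFiberSum_succ (hd : ∀ x, #{y | o y = o x} = d) (hf : f.FactorsThrough o)
    (lam : Fin (m + 1) → ℕ) :
    distinctFiberSum o f lam = (∑ x, f x ^ lam 0) * distinctFiberSum o f (Fin.tail lam) -
      d * ∑ i, distinctFiberSum o f (Fin.tail lam + Pi.single i (lam 0)) := by
  have hprod (i : Fin m) (c : Fin m → α) :
      ∏ j, f (c j) ^ (Fin.tail lam + Pi.single i (lam 0) : Fin m → ℕ) j =
        (∏ j, f (c j) ^ lam j.succ) * f (c i) ^ lam 0 := by
    simp only [Pi.add_apply, Fin.tail, pow_add, prod_mul_distrib, Pi.single_apply, pow_ite,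
      pow_zero, prod_ite_eq', mem_univ, if_true]
  rw [distinctFiberSum_eq_sum_mul_sum]
  simp only [distinctFiberSum, hprod]
  rw [sum_comm, mul_sum, mul_sum, ← sum_sub_distrib]
  refine sum_congr rfl fun c hc => ?_
  rw [sum_notMem_range_comp_eq_sub hd hf (mem_filter.1 hc).2, ← mul_sum, Fin.tail_def]
  ring

open scoped Classical in
theorem distinctFiberSum_eq_of_sum_pow_eq_zero (hd : ∀ x, #{y | o y = o x} = d)
    (hf : f.FactorsThrough o) (lam : Fin (m + 1) → ℕ) (hlam : ∀ i, 0 < lam i)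
    (hp : ∀ k, 0 < k → k < ∑ i, lam i → ∑ x, f x ^ k = 0) :
    distinctFiberSum o f lam = (-(d : R)) ^ m * m.factorial * ∑ x, f x ^ ∑ i, lam i := by
  induction m with
  | zero =>
    rw [distinctFiberSum_succ hd hf]
    simp [distinctFiberSum, Function.injective_of_subsingleton]
  | succ m ih =>
    have hlt : lam 0 < ∑ i, lam i :=
      single_lt_sum (Fin.succ_ne_zero 0) (mem_univ _) (mem_univ _) (hlam _) fun _ _ _ =>
        Nat.zero_le _
    have hpos (i j : Fin (m + 1)) :
        0 < (Fin.tail lam + Pi.single i (lam 0) : Fin (m + 1) → ℕ) j :=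
      Nat.add_pos_left (hlam j.succ) _
    have hsum (i : Fin (m + 1)) :
        ∑ j, (Fin.tail lam + Pi.single i (lam 0) : Fin (m + 1) → ℕ) j = ∑ j, lam j := by
      simp only [Pi.add_apply, sum_add_distrib, sum_pi_single', mem_univ, if_true, Fin.tail,
        Fin.sum_univ_succ lam, add_comm]
    have hmerge (i : Fin (m + 1)) :
        distinctFiberSum o f (Fin.tail lam + Pi.single i (lam 0) : Fin (m + 1) → ℕ) =
          (-(d : R)) ^ m * m.factorial * ∑ x, f x ^ ∑ i, lam i := by
      rw [ih _ (hpos i) (by rwa [hsum]), hsum]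
    rw [distinctFiberSum_succ hd hf, hp _ (hlam 0) hlt, sum_congr rfl fun i _ => hmerge i,
      sum_const, card_univ, Fintype.card_fin, nsmul_eq_mul, Nat.factorial_succ]
    push_cast
    ring

end DistinctFibers

section FrobeniusOrbits

variable {G : Type*} [CommGroup G] {q : ℕ}

theorem pow_pow_eq_self {M : Type*} [Monoid M] {x : M} (hx : x ^ q = x) (i : ℕ) :
    x ^ q ^ i = x := by
  simpa only [pow_iterate] using Function.iterate_fixed (f := (· ^ q)) hx i

theorem map_eq_of_frobOrbit_eq {M : Type*} [Monoid M] {ψ : G →* M} (hψ : ∀ c, ψ c ^ q = ψ c)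
    {x y : G} (h : frobOrbit q x = frobOrbit q y) : ψ x = ψ y := by
  have hx : x ∈ frobOrbit q x := ⟨0, by simp⟩
  obtain ⟨i, rfl⟩ := h ▸ hx
  rw [map_pow, pow_pow_eq_self (hψ y)]

open scoped Pointwise in
theorem frobOrbit_mul_of_pow_eq {x : G} (hx : x ^ q = x) (c : G) :
    frobOrbit q (x * c) = x • frobOrbit q c := by
  simp only [frobOrbit, mul_pow, pow_pow_eq_self hx, Set.smul_set_range, smul_eq_mul]

theorem frobDegree_mul_of_pow_eq {x : G} (hx : x ^ q = x) (c : G) :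
    frobDegree q (x * c) = frobDegree q c := by
  rw [frobDegree, frobOrbit_mul_of_pow_eq hx, Set.ncard_smul_set, frobDegree]

theorem sum_frobDegree_eq_zero [Fintype G] {R : Type*} [CommRing R] [IsDomain R] (ψ : G →* R)
    {x : G} (hx : x ^ q = x) (hψ : ψ x ≠ 1) (d : ℕ) : ∑ c with frobDegree q c = d, ψ c = 0 := by
  have htranslate : ∑ c with frobDegree q c = d, ψ c =
      ψ x * ∑ c with frobDegree q c = d, ψ c := by
    rw [mul_sum]
    refine (sum_equiv (Equiv.mulLeft x) (fun c => ?_) fun c _ => ?_).symm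
    · simp only [mem_filter_univ, Equiv.coe_mulLeft, frobDegree_mul_of_pow_eq hx]
    · rw [Equiv.coe_mulLeft, map_mul]
  exact (mul_left_eq_self₀.1 htranslate.symm).resolve_left hψ

theorem powCoprime_pow_apply (hq : (Nat.card G).Coprime q) (i : ℕ) (c : G) :
    (powCoprime hq ^ i : Equiv.Perm G) c = c ^ q ^ i := by
  rw [Equiv.Perm.coe_pow]
  exact congrFun (pow_iterate q i) c

theorem frobOrbit_eq_orbit [Finite G] (hq : (Nat.card G).Coprime q) (c : G) :
    frobOrbit q c = MulAction.orbit (Subgroup.zpowers (powCoprime hq : Equiv.Perm G)) c := by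
  ext y
  simp only [frobOrbit, Set.mem_range, ← powCoprime_pow_apply hq, MulAction.mem_orbit_iff,
    Subtype.exists, ← mem_powers_iff_mem_zpowers, Submonoid.mem_powers_iff]
  aesop

theorem frobOrbit_eq_iff [Finite G] (hq : (Nat.card G).Coprime q) {c y : G} :
    frobOrbit q y = frobOrbit q c ↔ y ∈ frobOrbit q c := by
  simp only [frobOrbit_eq_orbit hq, MulAction.orbit_eq_iff]

theorem frobDegree_dvd_iff [Finite G] (hq : (Nat.card G).Coprime q) (hq0 : 0 < q) (c : G) (e : ℕ) :
    frobDegree q c ∣ e ↔ c ^ (q ^ e - 1) = 1 := by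
  have := Fintype.ofFinite (MulAction.orbit (Subgroup.zpowers (powCoprime hq : Equiv.Perm G)) c)
  rw [frobDegree, frobOrbit_eq_orbit hq, ← Nat.card_coe_set_eq, Nat.card_eq_fintype_card,
    ← MulAction.minimalPeriod_eq_card, ← Function.isPeriodicPt_iff_minimalPeriod_dvd]
  change (powCoprime hq)^[e] c = c ↔ _
  rw [← Equiv.Perm.coe_pow, powCoprime_pow_apply, ← pow_sub_one_mul (pow_pos hq0 e).ne',
    mul_eq_right]

open scoped Classical in
theorem card_frobOrbit_eq_of_frobDegree_eq [Fintype G] (hq : (Nat.card G).Coprime q) {d : ℕ}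
    (x : {c : G // frobDegree q c = d}) :
    #{y : {c : G // frobDegree q c = d} | frobOrbit q y.1 = frobOrbit q x.1} = d := by
  have hfiber : Subtype.val '' {y : {c : G // frobDegree q c = d} |
      frobOrbit q y.1 = frobOrbit q x.1} = frobOrbit q x.1 := by
    ext y
    rw [← frobOrbit_eq_iff hq, Set.mem_image, Subtype.exists]
    refine ⟨?_, fun h => ⟨y, by rw [frobDegree, h, ← frobDegree, x.2], h, rfl⟩⟩
    rintro ⟨_, _, h, rfl⟩
    exact h
  calc #{y : {c : G // frobDegree q c = d} | frobOrbit q y.1 = frobOrbit q x.1}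
      = (frobOrbit q x.1).ncard := by
        rw [← Set.ncard_coe_finset, coe_filter_univ,
          ← Set.ncard_image_of_injective _ Subtype.val_injective, hfiber]
    _ = d := x.2

open scoped ArithmeticFunction.Moebius in
theorem sum_frobDegree_eq_sum_moebius [Fintype G] [DecidableEq G] {R : Type*} [Ring R] (hq0 : 0 < q)
    (hq : (Nat.card G).Coprime q) (f : G → R) {d : ℕ} (hd : 0 < d) :
    ∑ c with frobDegree q c = d, f c =
      ∑ x ∈ d.divisorsAntidiagonal, (μ x.1 : R) * ∑ c with c ^ (q ^ x.2 - 1) = 1, f c := by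
  refine ((ArithmeticFunction.sum_eq_iff_sum_mul_moebius_eq
    (f := fun e => ∑ c with frobDegree q c = e, f c)
    (g := fun e => ∑ c with c ^ (q ^ e - 1) = 1, f c)).1 (fun e he => ?_) d hd).symm
  rw [sum_fiberwise_eq_sum_filter]
  simp only [Nat.mem_divisors, frobDegree_dvd_iff hq hq0, he.ne', ne_eq, not_false_eq_true,
    and_true]

end FrobeniusOrbits

section CyclicGroups

variable {G : Type*} [CommGroup G] {g : G}

theorem ker_powMonoidHom_eq_zpowers [Finite G] (hg : ∀ x, x ∈ Subgroup.zpowers g) (m : ℕ) :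
    (powMonoidHom m : G →* G).ker =
      Subgroup.zpowers (g ^ (Nat.card G / (Nat.card G).gcd m)) := by
  have : IsCyclic G := ⟨g, hg⟩
  have horder : orderOf g = Nat.card G := orderOf_eq_card_of_forall_mem_zpowers hg
  have hgcd : (Nat.card G).gcd m ∣ Nat.card G := Nat.gcd_dvd_left _ _
  have hpos : 0 < (Nat.card G).gcd m := Nat.gcd_pos_of_pos_left m Nat.card_pos
  refine (Subgroup.eq_of_le_of_card_ge (Subgroup.zpowers_le.2 ?_) (le_of_eq ?_)).symm
  · rw [MonoidHom.mem_ker, powMonoidHom_apply, ← pow_mul, ← orderOf_dvd_iff_pow_eq_one, horder]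
    calc Nat.card G = Nat.card G / (Nat.card G).gcd m * (Nat.card G).gcd m :=
          (Nat.div_mul_cancel hgcd).symm
      _ ∣ Nat.card G / (Nat.card G).gcd m * m := mul_dvd_mul_left _ (Nat.gcd_dvd_right _ _)
  · rw [IsCyclic.card_powMonoidHom_ker, Nat.card_zpowers,
      orderOf_pow_of_dvd (Nat.div_pos (Nat.le_of_dvd Nat.card_pos hgcd) hpos).ne'
        (horder.symm ▸ Nat.div_dvd_of_dvd hgcd), horder, Nat.div_div_self hgcd Nat.card_pos.ne']

theorem forall_pow_eq_one_imp_map_eq_one_iff [Finite G] {M : Type*} [Monoid M]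
    (hg : ∀ x, x ∈ Subgroup.zpowers g) (ψ : G →* M) (m : ℕ) :
    (∀ c, c ^ m = 1 → ψ c = 1) ↔ ψ g ^ (Nat.card G / (Nat.card G).gcd m) = 1 := by
  calc (∀ c, c ^ m = 1 → ψ c = 1) ↔ (powMonoidHom m : G →* G).ker ≤ ψ.ker := Iff.rfl
    _ ↔ ψ g ^ (Nat.card G / (Nat.card G).gcd m) = 1 := by
      rw [ker_powMonoidHom_eq_zpowers hg, Subgroup.zpowers_le, MonoidHom.mem_ker, map_pow]

theorem map_pow_eq_self_of_orderOf_dvd [Finite G] {M : Type*} [Monoid M] {ψ : G →* M} {q : ℕ}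
    (hg : ∀ x, x ∈ Subgroup.zpowers g) (hq : 0 < q) (hψ : orderOf (ψ g) ∣ q - 1) (c : G) :
    ψ c ^ q = ψ c := by
  obtain ⟨j, rfl⟩ := mem_powers_iff_mem_zpowers.2 (hg c)
  have hpow : ψ g ^ q = ψ g := by
    rw [← pow_sub_one_mul hq.ne', orderOf_dvd_iff_pow_eq_one.1 hψ, one_mul]
  simp only [map_pow]
  rw [pow_right_comm, hpow]

theorem sum_pow_eq_one_eq_ite [Fintype G] [DecidableEq G] {R : Type*} [CommRing R] [IsDomain R]
    [DecidableEq R] (hg : ∀ x, x ∈ Subgroup.zpowers g) (ψ : G →* R) (m : ℕ) :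
    ∑ c with c ^ m = 1, ψ c =
      if ψ g ^ (Nat.card G / (Nat.card G).gcd m) = 1 then ((Nat.card G).gcd m : R) else 0 := by
  have : IsCyclic G := ⟨g, hg⟩
  set H : Subgroup G := (powMonoidHom m : G →* G).ker
  have htrivial : ψ.comp H.subtype = 1 ↔ ψ g ^ (Nat.card G / (Nat.card G).gcd m) = 1 := by
    rw [← forall_pow_eq_one_imp_map_eq_one_iff hg, DFunLike.ext_iff, Subtype.forall]
    rfl
  calc ∑ c with c ^ m = 1, ψ c = ∑ c : H, (ψ.comp H.subtype) c :=
        sum_subtype _ (fun c => by rw [mem_filter_univ]; rfl) _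
    _ = _ := by
      rw [sum_hom_units, ← Nat.card_eq_fintype_card, IsCyclic.card_powMonoidHom_ker]
      simp only [htrivial, Nat.cast_ite, Nat.cast_zero]

end CyclicGroups

section PowerSums

variable {G R : Type*} [CommGroup G] [Fintype G] [CommRing R] [IsDomain R] {g : G} {χ : G →* R}
  {q t D L : ℕ}

theorem sum_frobDegree_pow_eq_zero (hg : ∀ x, x ∈ Subgroup.zpowers g)
    (hχ : orderOf (χ g) = D * L) (hq : 1 < q) (htL : t * L ∣ q - 1) (hD : D ∣ q - 1)
    (h4 : Even D → 4 ∣ q - 1) (hG : t * Nat.card G = q ^ D - 1) {k : ℕ}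
    (hk : ¬D.gcd t * L ∣ k) (d : ℕ) : ∑ c with frobDegree q c = d, χ c ^ k = 0 := by
  rw [← mul_dvd_mul_div_gcd_sub_one_iff hq htL hD h4 hG, ← hχ, orderOf_dvd_iff_pow_eq_one,
    pow_mul, ← MonoidHom.pow_apply, ← forall_pow_eq_one_imp_map_eq_one_iff hg] at hk
  push Not at hk
  obtain ⟨x, hx, hψ⟩ := hk
  have hfixed : x ^ q = x := by rw [← pow_sub_one_mul (by omega : q ≠ 0), hx, one_mul]
  exact sum_frobDegree_eq_zero (χ ^ k) hfixed hψ d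

theorem sum_pow_sub_one_eq_one_pow_eq_zero [DecidableEq G] (hg : ∀ x, x ∈ Subgroup.zpowers g)
    (hχ : orderOf (χ g) = D * L) (hL : 0 < L) (hq : 1 < q) (hD : D ∣ q - 1)
    (h4 : Even D → 4 ∣ q - 1) (hG : t * Nat.card G = q ^ D - 1) {e : ℕ} (he : e ∣ D)
    (he1 : e ≠ 1) : ∑ c : G with c ^ (q ^ e - 1) = 1, χ c ^ L = 0 := by
  classical
  simp only [← MonoidHom.pow_apply]
  rw [sum_pow_eq_one_eq_ite hg, if_neg]
  rw [MonoidHom.pow_apply, ← pow_mul, ← orderOf_dvd_iff_pow_eq_one, hχ, mul_comm D,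
    Nat.mul_dvd_mul_iff_left hL]
  exact fun h => he1 (eq_one_of_dvd_div_gcd_pow_sub_one hq hD h4 hG he h)

theorem sum_pow_sub_one_eq_one_pow_of_coprime [DecidableEq G]
    (hg : ∀ x, x ∈ Subgroup.zpowers g)
    (hχ : orderOf (χ g) = D * L) (hq : 1 < q) (htL : t * L ∣ q - 1) (hD : D ∣ q - 1)
    (h4 : Even D → 4 ∣ q - 1) (hG : t * Nat.card G = q ^ D - 1) (hDt : D.Coprime t) :
    ∑ c : G with c ^ (q - 1) = 1, χ c ^ L = ((q - 1) / t : ℕ) := by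
  classical
  simp only [← MonoidHom.pow_apply]
  rw [sum_pow_eq_one_eq_ite hg, if_pos,
    gcd_sub_one_eq_mul_gcd hq (dvd_of_mul_right_dvd htL) hD h4 hG, hDt.gcd_eq_one, mul_one]
  rw [MonoidHom.pow_apply, ← pow_mul, ← orderOf_dvd_iff_pow_eq_one, hχ,
    mul_dvd_mul_div_gcd_sub_one_iff hq htL hD h4 hG, hDt.gcd_eq_one, one_mul]

theorem sum_frobDegree_pow_of_coprime (hg : ∀ x, x ∈ Subgroup.zpowers g)
    (hχ : orderOf (χ g) = D * L) (hL : 0 < L) (hq : 1 < q) (htL : t * L ∣ q - 1)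
    (hD : D ∣ q - 1) (h4 : Even D → 4 ∣ q - 1) (hG : t * Nat.card G = q ^ D - 1)
    (hDt : D.Coprime t) :
    ∑ c with frobDegree q c = D, χ c ^ L =
      (ArithmeticFunction.moebius D : R) * ((q - 1) / t : ℕ) := by
  classical
  have hD0 : 0 < D := Nat.pos_of_dvd_of_pos hD (by omega)
  rw [sum_frobDegree_eq_sum_moebius (by omega) (coprime_of_mul_eq_pow_sub_one (by omega) hD0.ne' hG)
    (fun c => χ c ^ L) hD0, Nat.sum_divisorsAntidiagonal
    (f := fun a e => (ArithmeticFunction.moebius a : R) * ∑ c with c ^ (q ^ e - 1) = 1, χ c ^ L),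
    sum_eq_single D]
  · rw [Nat.div_self hD0, pow_one,
      sum_pow_sub_one_eq_one_pow_of_coprime hg hχ hq htL hD h4 hG hDt]
  · intro a ha hne
    have haD : a ∣ D := Nat.dvd_of_mem_divisors ha
    rw [sum_pow_sub_one_eq_one_pow_eq_zero hg hχ hL hq hD h4 hG (Nat.div_dvd_of_dvd haD) ?_,
      mul_zero]
    exact fun h => hne (by rw [← Nat.div_mul_cancel haD, h, one_mul])
  · exact fun h => absurd (Nat.mem_divisors_self D hD0.ne') h

theorem distinctFiberSum_frobOrbit_eq_ite {d m : ℕ} (hg : ∀ x, x ∈ Subgroup.zpowers g)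
    (hq : 1 < q) (h4 : Even D → 4 ∣ q - 1) (hG : t * Nat.card G = q ^ D - 1) (hDt : D ∣ t * d)
    (hdD : d ∣ D) (lam : Fin (m + 1) → ℕ) (hlam : ∀ i, 0 < lam i)
    (hχ : orderOf (χ g) = D * ∑ i, lam i) (hdvd : t * d * ∑ i, lam i ∣ q - 1) :
    distinctFiberSum (fun c : {c : G // frobDegree q c = d} => frobOrbit q c.1)
        (fun c => χ c.1) lam =
      if D.gcd t = 1 then
        (ArithmeticFunction.moebius d : R) * (-(d : R)) ^ m * m.factorial * ((q - 1) / t : ℕ)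
      else 0 := by
  have hDL : D * ∑ i, lam i ∣ q - 1 := (mul_dvd_mul_right hDt _).trans hdvd
  have hD : D ∣ q - 1 := dvd_of_mul_right_dvd hDL
  have htL : t * ∑ i, lam i ∣ q - 1 := (mul_dvd_mul_right (dvd_mul_right t d) _).trans hdvd
  have hL : 0 < ∑ i, lam i := sum_pos (fun i _ => hlam i) univ_nonempty
  have hD0 : 0 < D := Nat.pos_of_dvd_of_pos hD (by omega)
  have hcop := coprime_of_mul_eq_pow_sub_one (by omega) hD0.ne' hG
  have hfixed := map_pow_eq_self_of_orderOf_dvd hg (by omega) (hχ ▸ hDL)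
  have hsubtype (k : ℕ) : ∑ c : {c : G // frobDegree q c = d}, χ c.1 ^ k =
      ∑ c with frobDegree q c = d, χ c ^ k :=
    (sum_subtype _ (fun c => mem_filter_univ c) fun c => χ c ^ k).symm
  have hvanish {k : ℕ} (hk : ¬D.gcd t * ∑ i, lam i ∣ k) :
      ∑ c : {c : G // frobDegree q c = d}, χ c.1 ^ k = 0 := by
    rw [hsubtype, sum_frobDegree_pow_eq_zero hg hχ hq htL hD h4 hG hk]
  have hsmall (k : ℕ) (hk : 0 < k) (hkL : k < ∑ i, lam i) :
      ∑ c : {c : G // frobDegree q c = d}, χ c.1 ^ k = 0 :=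
    hvanish fun h => hkL.not_ge (Nat.le_of_dvd hk (dvd_of_mul_left_dvd h))
  rw [distinctFiberSum_eq_of_sum_pow_eq_zero (card_frobOrbit_eq_of_frobDegree_eq hcop)
    (fun _ _ => map_eq_of_frobOrbit_eq hfixed) lam hlam hsmall]
  split_ifs with hgcd
  · obtain rfl : d = D := Nat.dvd_antisymm hdD (Nat.Coprime.dvd_of_dvd_mul_left hgcd hDt)
    rw [hsubtype, sum_frobDegree_pow_of_coprime hg hχ hL hq htL hD h4 hG hgcd]
    ring
  · rw [hvanish fun h => hgcd <| Nat.dvd_one.1 <|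
      Nat.dvd_of_mul_dvd_mul_right hL (by rwa [one_mul]), mul_zero]

end PowerSums

section Characters

theorem CharGroup.isCyclic (k : Type*) [Field k] [Finite k] : IsCyclic (CharGroup k) := by
  have : NeZero (Monoid.exponent kˣ) := ⟨Monoid.exponent_ne_zero_of_finite⟩
  obtain ⟨e⟩ := CommGroup.monoidHom_mulEquiv_of_hasEnoughRootsOfUnity kˣ ℂ
  exact isCyclic_of_surjective e.symm e.symm.surjective

theorem CharGroup.card (k : Type*) [Field k] [Finite k] :
    Nat.card (CharGroup k) = Nat.card k - 1 := by
  have : NeZero (Monoid.exponent kˣ) := ⟨Monoid.exponent_ne_zero_of_finite⟩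
  rw [← Nat.card_units]
  exact CommGroup.card_monoidHom_of_hasEnoughRootsOfUnity kˣ ℂ

theorem CharGroup.orderOf_apply_generator {k : Type*} [Field k] [Finite k] {ω : CharGroup k}
    (hω : ∀ α, α ∈ Subgroup.zpowers ω) (x : kˣ) : orderOf (ω x) = orderOf x := by
  have : NeZero (Monoid.exponent kˣ) := ⟨Monoid.exponent_ne_zero_of_finite⟩
  refine Nat.dvd_antisymm (orderOf_map_dvd (ω : kˣ →* ℂˣ) x) ?_
  rw [orderOf_dvd_iff_pow_eq_one]
  refine (CommGroup.forall_apply_eq_apply_iff kˣ (M := ℂ)).1 fun α => ?_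
  obtain ⟨j, rfl⟩ := hω α
  have hzpow (y : kˣ) : (ω ^ j) y = ω y ^ j := map_zpow (CharGroup.eval y) ω j
  change (ω ^ j) _ = (ω ^ j) 1
  rw [hzpow, hzpow, map_pow, pow_orderOf_eq_one, map_one]

variable {F K : Type*} [Field F] [Field K] [Finite K] [Algebra F K]

theorem normTranspose_injective : Function.Injective (normTranspose F K) := by
  intro α β h
  refine DFunLike.ext _ _ fun y => ?_
  obtain ⟨x, rfl⟩ := FiniteField.unitsMap_norm_surjective F K y
  exact DFunLike.congr_fun (F := Kˣ →* ℂˣ) h x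

theorem mul_card_charClass [Finite F] {δ : CharGroup F} (hδ : ∀ β, β ∈ Subgroup.zpowers δ)
    {t : ℕ} (ht : t ∣ Nat.card F - 1) :
    t * Nat.card (CharClass K δ t) = Nat.card F ^ Module.finrank F K - 1 := by
  have hq : 0 < Nat.card F - 1 := Nat.sub_pos_of_lt Finite.one_lt_card
  have horder : orderOf δ = Nat.card F - 1 := by
    rw [orderOf_eq_card_of_forall_mem_zpowers hδ, CharGroup.card]
  have hcard :
      Nat.card (Subgroup.zpowers (normTranspose F K (δ ^ ((Nat.card F - 1) / t)))) = t := by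
    rw [Nat.card_zpowers, orderOf_injective _ normTranspose_injective,
      orderOf_pow_of_dvd (Nat.div_pos (Nat.le_of_dvd hq ht) (Nat.pos_of_dvd_of_pos ht hq)).ne'
        (horder.symm ▸ Nat.div_dvd_of_dvd ht), horder, Nat.div_div_self ht hq.ne']
  have hlagrange := Subgroup.card_eq_card_quotient_mul_card_subgroup
    (Subgroup.zpowers (normTranspose F K (δ ^ ((Nat.card F - 1) / t))))
  rw [← Module.natCard_eq_pow_finrank, ← CharGroup.card, hlagrange, hcard, mul_comm]

variable {δ : CharGroup F} {ζ : Fˣ} {n D t dhat : ℕ}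

theorem exists_generator_orderOf_evalClass [Finite F] (hζ : orderOf ζ = n)
    (hD : Module.finrank F K = D) (ht : t ∣ n) (hDt : D ∣ t * dhat) {L : ℕ}
    (hn : n = t * dhat * L) :
    ∃ g : CharClass K δ t, (∀ x, x ∈ Subgroup.zpowers g) ∧
      orderOf (evalClass δ hζ hD ht hDt g) = D * L := by
  obtain ⟨ω, hω⟩ := (CharGroup.isCyclic K).exists_generator
  refine ⟨QuotientGroup.mk ω, fun x => ?_, ?_⟩
  · obtain ⟨α, rfl⟩ := QuotientGroup.mk_surjective x
    obtain ⟨j, rfl⟩ := hω α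
    exact ⟨j, rfl⟩
  · have horder : orderOf (Units.map (algebraMap F K : F →* K) ζ) = t * dhat * L :=
      (orderOf_injective _ (Units.map_injective (algebraMap F K).injective) ζ).trans (hζ.trans hn)
    have hpos : 0 < t * dhat * L := hn ▸ hζ ▸ orderOf_pos ζ
    obtain ⟨a, ha⟩ := hDt
    rw [ha] at horder hpos
    have hD0 : 0 < D := by grind
    have ha0 : 0 < a := by grind
    rw [evalClass_mk, CharGroup.orderOf_apply_generator hω, evalPoint, hD, ha,
      Nat.mul_div_cancel_left a hD0,
      orderOf_pow_of_dvd ha0.ne' (horder ▸ ⟨D * L, by ring⟩), horder]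
    exact Nat.div_eq_of_eq_mul_left ha0 (by ring)

theorem Zhat_eq_distinctFiberSum [Fintype (CharClass K δ t)] (hζ : orderOf ζ = n)
    (hD : Module.finrank F K = D) (ht : t ∣ n) (hDt : D ∣ t * dhat) {m : ℕ} (lam : Fin m → ℕ) :
    Zhat δ hζ hD ht hDt lam =
      distinctFiberSum
        (fun c : {c : CharClass K δ t // frobDegree (Nat.card F) c = dhat} =>
          frobOrbit (Nat.card F) c.1)
        (fun c => (Units.coeHom ℂ).comp (evalClass δ hζ hD ht hDt) c.1) lam := by
  classical
  rw [Zhat, distinctFiberSum]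
  symm
  refine sum_nbij (fun c i => (c i).1) (fun c hc => ?_) (fun c _ c' _ h => ?_) (fun c hc => ?_)
    fun c _ => rfl
  · simp only [mem_filter_univ] at hc ⊢
    exact ⟨fun i j hij => hc.ne hij, fun i => (c i).2⟩
  · exact funext fun i => Subtype.ext (congrFun h i)
  · simp only [mem_coe, mem_filter_univ] at hc
    refine ⟨fun i => ⟨c i, hc.2 i⟩, ?_, rfl⟩
    simp only [mem_coe, mem_filter_univ]
    exact fun i j h => of_not_not fun hij => hc.1 i j hij h

end Characters

end NewDegree

theorem lemmal_general {F K : Type*} [Field F] [Finite F] [Field K] [Finite K] [Algebra F K]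
    (q n D t dhat m : ℕ) (lam : Fin m → ℕ)
    (hF : Nat.card F = q) (hD : Module.finrank F K = D)
    (δ : NewDegree.CharGroup F) (hδ : ∀ β : NewDegree.CharGroup F, β ∈ Subgroup.zpowers δ)
    (ζ : Fˣ) (hζ : orderOf ζ = n)
    (h4 : Even D → q ≡ 1 [MOD 4]) (ht : t ∣ n)
    (hDt : D ∣ t * dhat) (hdD : dhat ∣ D)
    (hlam : ∀ i, 0 < lam i) (hn : n = dhat * t * ∑ i, lam i) :
    NewDegree.Zhat δ hζ hD ht hDt lam =
      if Nat.gcd D t = 1 then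
        (ArithmeticFunction.moebius dhat : ℂ) * (-(dhat : ℂ)) ^ (m - 1) *
          (Nat.factorial (m - 1) : ℂ) * (((q : ℂ) - 1) / (t : ℂ))
      else 0 := by
  subst hF
  have hq : 1 < Nat.card F := Finite.one_lt_card
  have hn' : n = t * dhat * ∑ i, lam i := by rw [hn, mul_comm dhat]
  obtain ⟨m, rfl⟩ : ∃ k, m = k + 1 := Nat.exists_eq_succ_of_ne_zero <| by
    rintro rfl
    exact (orderOf_pos ζ).ne' (hζ.trans (by simpa using hn))
  have hnq : n ∣ Nat.card F - 1 := Nat.card_units F ▸ hζ ▸ orderOf_dvd_natCard ζ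
  have htq : t ∣ Nat.card F - 1 := ht.trans hnq
  have := Fintype.ofFinite (NewDegree.CharClass K δ t)
  obtain ⟨g, hg, horder⟩ :=
    NewDegree.exists_generator_orderOf_evalClass (δ := δ) hζ hD ht hDt hn'
  have hcard := hD ▸ NewDegree.mul_card_charClass (K := K) hδ htq
  have hcast : (((Nat.card F - 1) / t : ℕ) : ℂ) = ((Nat.card F : ℂ) - 1) / t := by
    rw [Nat.cast_div_charZero htq, Nat.cast_pred (by omega)]
  rw [NewDegree.Zhat_eq_distinctFiberSum, NewDegree.distinctFiberSum_frobOrbit_eq_ite hg hq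
    (fun h => (Nat.modEq_iff_dvd' hq.le).1 (h4 h).symm) hcard hDt hdD lam hlam
    (orderOf_units.trans horder) (hn' ▸ hnq), hcast, Nat.add_sub_cancel]

theorem lemmal {F K : Type*} [Field F] [Finite F] [Field K] [Finite K] [Algebra F K]
    (q n D t dhat m : ℕ) (lam : Fin m → ℕ)
    (hF : Nat.card F = q) (hD : Module.finrank F K = D)
    (δ : NewDegree.CharGroup F) (hδ : ∀ β : NewDegree.CharGroup F, β ∈ Subgroup.zpowers δ)
    (ζ : Fˣ) (hζ : orderOf ζ = n)
    (hqodd : Odd n → q ≡ 1 [MOD n]) (hqeven : Even n → q ≡ 1 [MOD 2 * n])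
    (hDn : D ∣ n) (hdn : dhat ∣ n) (ht : t ∣ n)
    (hDt : D ∣ t * dhat) (hdD : dhat ∣ D)
    (hlam : ∀ i, 0 < lam i) (hn : n = dhat * t * ∑ i, lam i) :
    NewDegree.Zhat δ hζ hD ht hDt lam =
      if Nat.gcd D t = 1 then
        (ArithmeticFunction.moebius dhat : ℂ) * (-(dhat : ℂ)) ^ (m - 1) *
          (Nat.factorial (m - 1) : ℂ) * (((q : ℂ) - 1) / (t : ℂ))
      else 0 := by
  refine lemmal_general q n D t dhat m lam hF hD δ hδ ζ hζ (fun h => ?_) ht hDt hdD hlam hn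
  have hn2 : Even n := h.trans_dvd hDn
  exact (hqeven hn2).of_dvd (mul_dvd_mul_left 2 hn2.two_dvd)
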